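/- Let $\{W(t),t\ge 0\}$ be a standard Brownian motion, let $\Psi(x)=\int_x^\infty e^{-u^2/2}\,\frac{du}{\sqrt{2\pi}}$, and let $0<a\le b<\infty$. If $a=b$, the expressions below are read with $\sqrt{a/(b-a)}=+\infty$, $\arctan(+\infty)=\pi/2$ and $\Psi(x/\sqrt{b-a})=\Psi(+\infty)=0$ for $x>0$. (i) For every real $M$, $$\mathbf P\Big\{\inf_{a\le t\le b}|W(t)-M|=0\Big\}=-\sqrt{\frac2\pi}\,\frac{|M|}{\sqrt a}\int_0^{\sqrt{a/b}}e^{-\frac{(Mu)^2}{2a}}\left[\int_{|x|\le |M|\sqrt{(1-u^2)/a}}e^{-x^2/2}\,\frac{dx}{\sqrt{2\pi}}\right]du+\left[1-\frac2\pi\,e^{-\frac{M^2}{2a}}\arctan\sqrt{\frac a{b-a}}\right].$$ (ii) In particular, $$\mathbf P\Big\{\inf_{a\le t\le b}|W(t)|=0\Big\}=1-\frac2\pi\arctan\sqrt{\frac a{b-a}}.$$ (iii) For every real $c>0$, $$\mathbf P\Big\{0<\inf_{a\le t\le b}|W(t)|<c\Big\}=2\int_0^{c/\sqrt a}\Big(1-2\Psi\Big(\frac{u\sqrt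 a}{\sqrt{b-a}}\Big)\Big)\frac{e^{-u^2/2}}{\sqrt{2\pi}}\,du+4\int_{c/\sqrt a}^\infty\Big(\Psi\Big(\frac{u\sqrt a-c}{\sqrt{b-a}}\Big)-\Psi\Big(\frac{u\sqrt a}{\sqrt{b-a}}\Big)\Big)\frac{e^{-u^2/2}}{\sqrt{2\pi}}\,du.$$ -/

import Mathlib

open MeasureTheory ProbabilityTheory Set
open scoped NNReal

/-- `β = inf_{a ≤ t ≤ b} |W(t) - M|` for the path of `W` at `ω`. -/
noncomputable def infAbsSub {Ω : Type*} (W : ℝ≥0 → Ω → ℝ) (M : ℝ) (a b : ℝ≥0) (ω : Ω) : ℝ :=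
  ⨅ t : Set.Icc a b, |W t ω - M|

/-- The standard Gaussian density `e^{-x²/2} / √(2π)`. -/
noncomputable def gaussDensity (x : ℝ) : ℝ :=
  Real.exp (-x ^ 2 / 2) / √(2 * Real.pi)

/-- The standard Gaussian tail `Ψ(x) = ∫_x^∞ e^{-u²/2} du / √(2π)`. -/
noncomputable def gaussTail (x : ℝ) : ℝ :=
  ∫ u in Set.Ioi x, gaussDensity u

/-- `Ψ(x / √d)` for `d ≥ 0`. At `d = 0` (only met with `x > 0`, up to a null set) the quotient
is `+∞` and the value is `Ψ(+∞) = 0`. -/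
noncomputable def gaussTailDiv (x d : ℝ) : ℝ :=
  if d = 0 then 0 else gaussTail (x / √d)

/-- `arctan √(x / d)` for `x > 0`, `d ≥ 0`. At `d = 0` the quotient is `+∞` and the value is
`arctan(+∞) = π / 2`. -/
noncomputable def arctanSqrtDiv (x d : ℝ) : ℝ :=
  if d = 0 then Real.pi / 2 else Real.arctan √(x / d)

open Filter Topology

/-! Condition on `W a`, distributed as √a·Z with Z standard normal: after time a the increments form
a Brownian motion independent of it (`measureReal_eq_integral_section`). By the reflection principle
(`measureReal_exists_gt`) and path continuity, a path starting at distance y > 0 from M reaches M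
within time b - a with probability 2Ψ(y/√(b-a)), and comes closer than c with probability 1 if y < c
and 2Ψ((y-c)/√(b-a)) otherwise. Integrating the difference of the two probabilities over Z gives
(iii).

For (i), put m = M/√a and r = √(a/(b-a)); the probability is the mean of 2Ψ(r|Z-m|). The closed form
is proved by differentiating in r (`one_sub_integral_gaussTail_eq`): completing the square evaluates
the derivative of the mean, its two terms are the derivatives of the arctangent and of
`wedgeIntegral` at r/√(1+r²) = √(a/b), and everything agrees at r = 0. The case a = b is the limit r
→ ∞ (`one_eq_wedgeIntegral_add`). Part (ii) is M = 0.

The reflection principle is proved on finite sets of times. A discrete path overshoots the level, so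
exact reflection is replaced by two inequalities, each of which survives the passage to continuous
time. -/

/-! ### Gaussian density and tail. -/

lemma gaussDensity_eq_gaussianPDFReal : gaussDensity = gaussianPDFReal 0 1 := by
  ext x
  simp [gaussDensity, gaussianPDFReal, div_eq_inv_mul]

lemma continuous_gaussDensity : Continuous gaussDensity := by
  unfold gaussDensity; fun_prop

lemma gaussDensity_nonneg (x : ℝ) : 0 ≤ gaussDensity x := by
  unfold gaussDensity; positivity

lemma gaussDensity_neg (x : ℝ) : gaussDensity (-x) = gaussDensity x := by
  simp [gaussDensity]

lemma gaussDensity_abs (x : ℝ) : gaussDensity |x| = gaussDensity x := by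
  simp [gaussDensity]

lemma gaussDensity_le (x : ℝ) : gaussDensity x ≤ gaussDensity 0 := by
  unfold gaussDensity
  gcongr ?_ / _
  refine Real.exp_le_exp.2 ?_
  nlinarith [sq_nonneg x]

lemma integrable_gaussDensity : Integrable gaussDensity := by
  rw [gaussDensity_eq_gaussianPDFReal]; exact integrable_gaussianPDFReal 0 1

lemma integral_gaussDensity : ∫ x, gaussDensity x = 1 := by
  rw [gaussDensity_eq_gaussianPDFReal]; exact integral_gaussianPDFReal_eq_one 0 one_ne_zero

lemma hasDerivAt_gaussDensity (x : ℝ) : HasDerivAt gaussDensity (-x * gaussDensity x) x := by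
  unfold gaussDensity
  have h : HasDerivAt (fun x : ℝ ↦ -x ^ 2 / 2) (-x) x := by
    refine ((hasDerivAt_pow 2 x).fun_neg.div_const 2).congr_deriv ?_
    norm_num
    ring
  refine (h.exp.div_const _).congr_deriv ?_
  ring

lemma gaussDensity_mul (x y : ℝ) :
    gaussDensity x * gaussDensity y = Real.exp (-(x ^ 2 + y ^ 2) / 2) / (2 * Real.pi) := by
  unfold gaussDensity
  rw [div_mul_div_comm, ← Real.exp_add, Real.mul_self_sqrt (by positivity)]
  ring_nf

lemma integrable_id_mul_gaussDensity : Integrable fun x ↦ x * gaussDensity x := by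
  have := (integrable_mul_exp_neg_mul_sq (b := 1 / 2) (by norm_num)).div_const √(2 * Real.pi)
  refine this.congr (ae_of_all _ fun x ↦ ?_)
  simp only [gaussDensity]
  ring_nf

lemma tendsto_gaussDensity_atTop : Tendsto gaussDensity atTop (𝓝 0) := by
  have h : Tendsto (fun x : ℝ ↦ -x ^ 2 / 2) atTop atBot := by
    have h2 : Tendsto (fun x : ℝ ↦ x ^ 2 / 2) atTop atTop :=
      (tendsto_pow_atTop two_ne_zero).atTop_div_const (by norm_num)
    refine (tendsto_neg_atTop_atBot.comp h2).congr fun x ↦ ?_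
    simp [neg_div]
  have h3 := (Real.tendsto_exp_atBot.comp h).div_const √(2 * Real.pi)
  rwa [zero_div] at h3

lemma integral_Ioi_id_mul_gaussDensity (x : ℝ) :
    ∫ u in Ioi x, u * gaussDensity u = gaussDensity x := by
  have := integral_Ioi_of_hasDerivAt_of_tendsto' (a := x) (f := fun u ↦ -gaussDensity u)
    (f' := fun u ↦ u * gaussDensity u) (m := -0)
    (fun u _ ↦ by simpa using (hasDerivAt_gaussDensity u).fun_neg)
    integrable_id_mul_gaussDensity.integrableOn tendsto_gaussDensity_atTop.neg
  simpa using this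

lemma gaussTail_sub_gaussTail (x y : ℝ) :
    gaussTail x - gaussTail y = ∫ u in x..y, gaussDensity u :=
  intervalIntegral.integral_Ioi_sub_Ioi' integrable_gaussDensity.integrableOn
    integrable_gaussDensity.integrableOn

lemma gaussTail_nonneg (x : ℝ) : 0 ≤ gaussTail x :=
  integral_nonneg gaussDensity_nonneg

lemma gaussTail_le_one (x : ℝ) : gaussTail x ≤ 1 :=
  integral_gaussDensity ▸
    setIntegral_le_integral integrable_gaussDensity (ae_of_all _ gaussDensity_nonneg)

lemma gaussTail_neg (x : ℝ) : gaussTail (-x) = 1 - gaussTail x := by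
  have h := integral_comp_neg_Ioi x gaussDensity
  have h2 := integral_comp_neg_Iic x gaussDensity
  have h3 := intervalIntegral.integral_Iic_add_Ioi (b := x) (μ := volume)
    integrable_gaussDensity.integrableOn integrable_gaussDensity.integrableOn
  simp only [gaussDensity_neg, integral_gaussDensity] at h h2 h3
  unfold gaussTail
  linarith

lemma gaussTail_zero : gaussTail 0 = 1 / 2 := by
  have := gaussTail_neg 0
  rw [neg_zero] at this
  linarith

lemma gaussTail_eq (x : ℝ) : gaussTail x = 1 / 2 - ∫ u in (0 : ℝ)..x, gaussDensity u := by
  rw [← gaussTail_sub_gaussTail, gaussTail_zero]; ring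

lemma hasDerivAt_gaussTail (x : ℝ) : HasDerivAt gaussTail (-gaussDensity x) x := by
  have h := intervalIntegral.integral_hasDerivAt_right
    (continuous_gaussDensity.intervalIntegrable 0 x)
    (continuous_gaussDensity.stronglyMeasurableAtFilter _ _) continuous_gaussDensity.continuousAt
  rw [show gaussTail = fun x ↦ 1 / 2 - ∫ u in (0 : ℝ)..x, gaussDensity u from
    funext gaussTail_eq]
  exact h.const_sub _

lemma continuous_gaussTail : Continuous gaussTail :=
  continuous_iff_continuousAt.2 fun x ↦ (hasDerivAt_gaussTail x).continuousAt

lemma tendsto_gaussTail_atTop : Tendsto gaussTail atTop (𝓝 0) := by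
  have h := intervalIntegral_tendsto_integral_Ioi 0
    integrable_gaussDensity.integrableOn tendsto_id
  have h2 := h.const_sub (gaussTail 0)
  simp only [id] at h2
  rw [show gaussTail 0 - ∫ x in Ioi 0, gaussDensity x = 0 from sub_self _] at h2
  refine h2.congr fun x ↦ ?_
  rw [← gaussTail_sub_gaussTail]; ring

lemma setIntegral_abs_le_gaussDensity {t : ℝ} (ht : 0 ≤ t) :
    ∫ x in {x : ℝ | |x| ≤ t}, gaussDensity x = 1 - 2 * gaussTail t := by
  have : {x : ℝ | |x| ≤ t} = Icc (-t) t := by ext x; simp [abs_le]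
  rw [this, integral_Icc_eq_integral_Ioc, ← intervalIntegral.integral_of_le (by linarith),
    ← gaussTail_sub_gaussTail, gaussTail_neg]
  ring

/-! ### The mean of 2Ψ(r|Z-m|) in closed form. -/

/-- The integral of |x-μ| is twice that of x-μ over (μ,∞) minus that of x-μ over the whole line, and
the latter is -μ. -/
lemma integral_abs_sub_mul_gaussDensity (μ : ℝ) :
    ∫ x, |x - μ| * gaussDensity x = 2 * gaussDensity μ + μ * (1 - 2 * gaussTail μ) := by
  have hi : Integrable fun x ↦ (x - μ) * gaussDensity x := by
    simp only [sub_mul]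
    exact integrable_id_mul_gaussDensity.sub (integrable_gaussDensity.const_mul _)
  have hj : Integrable fun x ↦ |x - μ| * gaussDensity x := by
    refine hi.abs.congr (ae_of_all _ fun x ↦ ?_)
    simp [abs_mul, abs_of_nonneg (gaussDensity_nonneg x)]
  have h1 : ∫ x in Ioi μ, (x - μ) * gaussDensity x = gaussDensity μ - μ * gaussTail μ := by
    simp only [sub_mul]
    rw [integral_sub integrable_id_mul_gaussDensity.integrableOn
      (integrable_gaussDensity.const_mul _).integrableOn, integral_Ioi_id_mul_gaussDensity,
      integral_const_mul, gaussTail]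
  have h2 : ∫ x, (x - μ) * gaussDensity x = -μ := by
    simp only [sub_mul]
    have h0 : ∫ x, x * gaussDensity x = 0 := by
      have := integral_neg_eq_self (fun x ↦ x * gaussDensity x) volume
      simp only [gaussDensity_neg, neg_mul, integral_neg] at this
      linarith
    rw [integral_sub integrable_id_mul_gaussDensity (integrable_gaussDensity.const_mul _),
      integral_const_mul, integral_gaussDensity, h0]
    ring
  have h3 := intervalIntegral.integral_Iic_add_Ioi (b := μ) (μ := volume)
    hi.integrableOn hi.integrableOn
  have h4 : ∫ x in Iic μ, |x - μ| * gaussDensity x = - ∫ x in Iic μ, (x - μ) * gaussDensity x := by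
    rw [← integral_neg]
    refine setIntegral_congr_fun measurableSet_Iic fun x hx ↦ ?_
    rw [abs_of_nonpos (sub_nonpos.2 hx)]; ring
  have h5 : ∫ x in Ioi μ, |x - μ| * gaussDensity x = ∫ x in Ioi μ, (x - μ) * gaussDensity x := by
    refine setIntegral_congr_fun measurableSet_Ioi fun x hx ↦ ?_
    rw [abs_of_nonneg (sub_nonneg.2 (le_of_lt hx))]
  rw [← intervalIntegral.integral_Iic_add_Ioi (b := μ) hj.integrableOn hj.integrableOn, h4, h5]
  linarith

lemma integral_abs_sub_mul_gaussDensity_mul_gaussDensity (s m : ℝ) :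
    ∫ z, |z - m| * gaussDensity (s * (z - m)) * gaussDensity z =
      (1 + s ^ 2)⁻¹ * gaussDensity (m * s / √(1 + s ^ 2)) *
        (2 * gaussDensity (m / √(1 + s ^ 2)) +
          m / √(1 + s ^ 2) * (1 - 2 * gaussTail (m / √(1 + s ^ 2)))) := by
  set q := √(1 + s ^ 2) with hq
  have hq0 : 0 < q := by positivity
  have hq2 : 1 + s ^ 2 = q ^ 2 := by rw [hq, Real.sq_sqrt (by positivity)]
  rw [hq2, ← integral_abs_sub_mul_gaussDensity]
  -- The substitution x = qz - s²m/q completes the square: s²(z-m)² + z² = (ms/q)² + x², while x -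
  -- m/q = q(z-m).
  have h := Measure.integral_comp_mul_left
    (fun x ↦ |(x - s ^ 2 * m / q) - m / q| * gaussDensity (x - s ^ 2 * m / q)) q
  rw [integral_sub_right_eq_self (fun x ↦ |x - m / q| * gaussDensity x), smul_eq_mul,
    abs_of_pos (inv_pos.2 hq0)] at h
  rw [pow_two q, mul_inv, mul_assoc, mul_assoc, mul_left_comm q⁻¹ (gaussDensity _), ← h,
    ← integral_const_mul, ← integral_const_mul]
  refine integral_congr_ae (ae_of_all _ fun z ↦ ?_)
  have e1 : q * z - s ^ 2 * m / q - m / q = q * (z - m) := by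
    field_simp
    linear_combination -(m * hq2)
  simp only [e1, abs_mul, abs_of_pos hq0]
  have e2 : gaussDensity (s * (z - m)) * gaussDensity z =
      gaussDensity (m * s / q) * gaussDensity (q * z - s ^ 2 * m / q) := by
    rw [gaussDensity_mul, gaussDensity_mul]
    congr 4
    field_simp
    have : q ^ 4 = (1 + s ^ 2) ^ 2 := by rw [hq2]; ring
    ring_nf
    rw [this, ← hq2]
    ring
  rw [mul_assoc, e2]
  field_simp

lemma integrable_gaussTail_mul_gaussDensity (r m : ℝ) :
    Integrable fun z ↦ 2 * gaussTail (r * |z - m|) * gaussDensity z := by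
  refine (integrable_gaussDensity.const_mul 2).mono' ?_ (ae_of_all _ fun z ↦ ?_)
  · have := continuous_gaussTail
    have := continuous_gaussDensity
    exact Continuous.aestronglyMeasurable (by fun_prop)
  · rw [Real.norm_of_nonneg (mul_nonneg (mul_nonneg zero_le_two (gaussTail_nonneg _))
      (gaussDensity_nonneg _))]
    exact mul_le_mul_of_nonneg_right
      (by linarith [gaussTail_le_one (r * |z - m|)]) (gaussDensity_nonneg _)

lemma integrable_abs_sub_mul_gaussDensity (m : ℝ) :
    Integrable fun z ↦ |z - m| * gaussDensity z := by
  have hi : Integrable fun x ↦ (x - m) * gaussDensity x := by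
    simp only [sub_mul]
    exact integrable_id_mul_gaussDensity.sub (integrable_gaussDensity.const_mul _)
  refine hi.abs.congr (ae_of_all _ fun x ↦ ?_)
  simp [abs_mul, abs_of_nonneg (gaussDensity_nonneg x)]

/-- Differentiation under the integral: since the density is at most its value at 0, the bound
2φ(0)|z-m|φ(z), with φ the density, works for all r at once. -/
lemma hasDerivAt_integral_gaussTail (r m : ℝ) :
    HasDerivAt (fun r ↦ ∫ z, 2 * gaussTail (r * |z - m|) * gaussDensity z)
      (-2 * ∫ z, |z - m| * gaussDensity (r * (z - m)) * gaussDensity z) r := by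
  have cT := continuous_gaussTail
  have cD := continuous_gaussDensity
  have h := (hasDerivAt_integral_of_dominated_loc_of_deriv_le (μ := volume) (s := univ) (x₀ := r)
    (F := fun r z ↦ 2 * gaussTail (r * |z - m|) * gaussDensity z)
    (F' := fun r z ↦ -2 * (|z - m| * gaussDensity (r * (z - m)) * gaussDensity z))
    (bound := fun z ↦ 2 * gaussDensity 0 * (|z - m| * gaussDensity z))
    univ_mem (.of_forall fun x ↦ Continuous.aestronglyMeasurable (by fun_prop))
    (integrable_gaussTail_mul_gaussDensity r m)
    (Continuous.aestronglyMeasurable (by fun_prop)) (ae_of_all _ fun z x _ ↦ ?_)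
    ((integrable_abs_sub_mul_gaussDensity m).const_mul _) (ae_of_all _ fun z x _ ↦ ?_)).2
  · rwa [integral_const_mul] at h
  · rw [norm_mul, norm_neg, Real.norm_two, Real.norm_of_nonneg (mul_nonneg (mul_nonneg
      (abs_nonneg _) (gaussDensity_nonneg _)) (gaussDensity_nonneg _))]
    have := mul_le_mul_of_nonneg_right (gaussDensity_le (x * (z - m)))
      (mul_nonneg (abs_nonneg (z - m)) (gaussDensity_nonneg z))
    linarith
  · have h1 : HasDerivAt (fun x ↦ x * |z - m|) |z - m| x := by
      simpa using (hasDerivAt_id x).mul_const |z - m|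
    have h2 := (((hasDerivAt_gaussTail (x * |z - m|)).comp x h1).const_mul 2).mul_const
      (gaussDensity z)
    refine h2.congr_deriv ?_
    rw [← gaussDensity_abs (x * (z - m)), ← gaussDensity_abs (x * |z - m|), abs_mul, abs_mul,
      abs_abs]
    ring

/-- The integral over `u` in the distribution of the zero set of Brownian motion, in terms of
`m = |M| / √a`. -/
noncomputable def wedgeIntegral (m y : ℝ) : ℝ :=
  ∫ u in (0 : ℝ)..y, Real.exp (-(m * u) ^ 2 / 2) * (1 - 2 * gaussTail (m * √(1 - u ^ 2)))

lemma hasDerivAt_wedgeIntegral (m y : ℝ) :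
    HasDerivAt (wedgeIntegral m)
      (Real.exp (-(m * y) ^ 2 / 2) * (1 - 2 * gaussTail (m * √(1 - y ^ 2)))) y := by
  have cT := continuous_gaussTail
  have hc : Continuous fun u ↦
      Real.exp (-(m * u) ^ 2 / 2) * (1 - 2 * gaussTail (m * √(1 - u ^ 2))) := by fun_prop
  exact intervalIntegral.integral_hasDerivAt_right (hc.intervalIntegrable 0 y)
    (hc.stronglyMeasurableAtFilter _ _) hc.continuousAt

lemma hasDerivAt_div_sqrt_one_add_sq (r : ℝ) :
    HasDerivAt (fun r : ℝ ↦ r / √(1 + r ^ 2)) (((1 + r ^ 2) * √(1 + r ^ 2))⁻¹) r := by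
  have hpos : 0 < 1 + r ^ 2 := by positivity
  have h1 : HasDerivAt (fun r : ℝ ↦ 1 + r ^ 2) (2 * r) r := by
    simpa using (hasDerivAt_pow 2 r).const_add 1
  have h2 := (hasDerivAt_id r).div (h1.sqrt hpos.ne') (Real.sqrt_pos.2 hpos).ne'
  refine h2.congr_deriv ?_
  have hs := Real.sq_sqrt hpos.le
  have hs0 := Real.sqrt_pos.2 hpos
  simp only [id, one_mul]
  field_simp
  rw [hs]
  ring

/-- The difference of the two sides vanishes at r = 0, where Ψ(0) = 1/2, and has derivative zero. -/
lemma one_sub_integral_gaussTail_eq (m r : ℝ) :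
    1 - ∫ z, 2 * gaussTail (r * |z - m|) * gaussDensity z =
      √(2 / Real.pi) * m * wedgeIntegral m (r / √(1 + r ^ 2)) +
        2 / Real.pi * Real.exp (-m ^ 2 / 2) * Real.arctan r := by
  set f : ℝ → ℝ := fun r ↦ (1 - ∫ z, 2 * gaussTail (r * |z - m|) * gaussDensity z) -
    (√(2 / Real.pi) * m * wedgeIntegral m (r / √(1 + r ^ 2)) +
        2 / Real.pi * Real.exp (-m ^ 2 / 2) * Real.arctan r) with hf
  suffices H : f r = f 0 by
    have h0 : f 0 = 0 := by
      simp [hf, gaussTail_zero, wedgeIntegral, integral_gaussDensity]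
    rw [h0] at H
    exact sub_eq_zero.1 H
  have hd : ∀ r, HasDerivAt f 0 r := by
    intro r
    have h1 := (hasDerivAt_integral_gaussTail r m).const_sub 1
    have h2 := (((hasDerivAt_wedgeIntegral m (r / √(1 + r ^ 2))).comp r
      (hasDerivAt_div_sqrt_one_add_sq r)).const_mul (√(2 / Real.pi) * m)).add
      ((Real.hasDerivAt_arctan r).const_mul (2 / Real.pi * Real.exp (-m ^ 2 / 2)))
    refine (h1.sub h2).congr_deriv ?_
    rw [integral_abs_sub_mul_gaussDensity_mul_gaussDensity]
    set q := √(1 + r ^ 2) with hq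
    have hq0 : 0 < q := by positivity
    have hq2 : 1 + r ^ 2 = q ^ 2 := by rw [hq, Real.sq_sqrt (by positivity)]
    -- This makes the tail in the integrand of `wedgeIntegral` match the tail Ψ(m/q) produced by
    -- completing the square.
    have e1 : √(1 - (r / q) ^ 2) = 1 / q := by
      rw [Real.sqrt_eq_iff_eq_sq _ (by positivity)]
      · field_simp; linarith
      · rw [sub_nonneg, div_pow, div_le_one (by positivity)]; linarith
    rw [e1, hq2, mul_one_div]
    have e2 : gaussDensity (m * r / q) * gaussDensity (m / q) =
        Real.exp (-m ^ 2 / 2) / (2 * Real.pi) := by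
      rw [gaussDensity_mul]
      congr 3
      field_simp
      linear_combination -m ^ 2 * hq2
    have e3 : √(2 / Real.pi) * Real.exp (-(m * (r / q)) ^ 2 / 2) =
        2 * gaussDensity (m * r / q) := by
      unfold gaussDensity
      have : √(2 / Real.pi) = 2 / √(2 * Real.pi) := by
        rw [eq_div_iff (by positivity), ← Real.sqrt_mul (by positivity)]
        rw [show 2 / Real.pi * (2 * Real.pi) = 2 ^ 2 by field_simp,
          Real.sqrt_sq zero_le_two]
      rw [this, mul_div_assoc m]
      ring
    have e4 : (2 : ℝ) / Real.pi * Real.exp (-m ^ 2 / 2) =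
        4 * (gaussDensity (m * r / q) * gaussDensity (m / q)) := by
      rw [e2]; field_simp; norm_num
    rw [e4]
    linear_combination (-m * (1 - 2 * gaussTail (m / q)) * (q ^ 2 * q)⁻¹) * e3
  exact is_const_of_deriv_eq_zero (fun x ↦ (hd x).differentiableAt) (fun x ↦ (hd x).deriv) r 0

lemma tendsto_div_sqrt_one_add_sq :
    Tendsto (fun r : ℝ ↦ r / √(1 + r ^ 2)) atTop (𝓝 1) := by
  have h : Tendsto (fun r : ℝ ↦ √(1 - (1 + r ^ 2)⁻¹)) atTop (𝓝 √(1 - 0)) := by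
    refine (Real.continuous_sqrt.tendsto _).comp (Tendsto.const_sub _ ?_)
    exact tendsto_inv_atTop_zero.comp
      (tendsto_atTop_add_const_left _ _ (tendsto_pow_atTop two_ne_zero))
  rw [sub_zero, Real.sqrt_one] at h
  refine h.congr' ((eventually_ge_atTop 0).mono fun r hr ↦ ?_)
  rw [Real.sqrt_eq_iff_eq_sq _ (by positivity), div_pow, Real.sq_sqrt (by positivity)]
  · field_simp; ring
  · rw [sub_nonneg]; exact inv_le_one_of_one_le₀ (by nlinarith)

lemma tendsto_integral_gaussTail (m : ℝ) :
    Tendsto (fun r : ℝ ↦ ∫ z, 2 * gaussTail (r * |z - m|) * gaussDensity z) atTop (𝓝 0) := by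
  have h := tendsto_integral_filter_of_dominated_convergence (μ := volume) (l := atTop)
    (F := fun r z ↦ 2 * gaussTail (r * |z - m|) * gaussDensity z) (f := fun _ ↦ (0 : ℝ))
    (fun z ↦ 2 * gaussDensity z)
    (.of_forall fun r ↦ (integrable_gaussTail_mul_gaussDensity r m).aestronglyMeasurable)
    (.of_forall fun r ↦ ae_of_all _ fun z ↦ ?_) (integrable_gaussDensity.const_mul 2) ?_
  · simpa using h
  · rw [Real.norm_of_nonneg (mul_nonneg (mul_nonneg zero_le_two (gaussTail_nonneg _))
      (gaussDensity_nonneg _))]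
    exact mul_le_mul_of_nonneg_right
      (by linarith [gaussTail_le_one (r * |z - m|)]) (gaussDensity_nonneg _)
  · have : ∀ᵐ z : ℝ, z ≠ m := by simp [ae_iff]
    filter_upwards [this] with z hz
    have := tendsto_gaussTail_atTop.comp
      (tendsto_id.atTop_mul_const (abs_pos.2 (sub_ne_zero.2 hz)))
    simpa using (this.const_mul 2).mul_const (gaussDensity z)

/-- The limit r → ∞ of `one_sub_integral_gaussTail_eq`; it settles the degenerate case a = b. -/
lemma one_eq_wedgeIntegral_add (m : ℝ) :
    1 = √(2 / Real.pi) * m * wedgeIntegral m 1 + Real.exp (-m ^ 2 / 2) := by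
  have h1 := (tendsto_integral_gaussTail m).const_sub 1
  simp only [one_sub_integral_gaussTail_eq] at h1
  have h2 := (((hasDerivAt_wedgeIntegral m 1).continuousAt.tendsto.comp
    tendsto_div_sqrt_one_add_sq).const_mul (√(2 / Real.pi) * m)).add
    ((Real.tendsto_arctan_atTop.mono_right nhdsWithin_le_nhds).const_mul
      (2 / Real.pi * Real.exp (-m ^ 2 / 2)))
  have := tendsto_nhds_unique h1 h2
  rw [sub_zero] at this
  convert this using 2
  field_simp

/-! ### The reflection principle. -/

section

variable {Ω : Type*}

/-- `t` is the first time in `F` at which the path `B · ω` exceeds `x`. -/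
def firstExceed (B : ℝ≥0 → Ω → ℝ) (F : Finset ℝ≥0) (x : ℝ) (t : ℝ≥0) : Set Ω :=
  {ω | (∀ s ∈ F, s < t → B s ω ≤ x) ∧ x < B t ω}

lemma biUnion_firstExceed (B : ℝ≥0 → Ω → ℝ) (F : Finset ℝ≥0) (x : ℝ) :
    ⋃ t ∈ F, firstExceed B F x t = {ω | ∃ t ∈ F, x < B t ω} := by
  ext ω
  simp only [mem_iUnion, firstExceed, mem_ofPred_eq, exists_prop]
  constructor
  · rintro ⟨t, ht, -, h⟩
    exact ⟨t, ht, h⟩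
  · rintro ⟨t, ht, h⟩
    obtain ⟨u, hu⟩ := (F.filter fun t ↦ x < B t ω).exists_minimal ⟨t, by simp [ht, h]⟩
    have hu1 := Finset.mem_filter.1 hu.prop
    refine ⟨u, hu1.1, fun s hs hsu ↦ not_lt.1 fun hx ↦ ?_, hu1.2⟩
    exact hsu.not_ge (hu.le_of_le (Finset.mem_filter.2 ⟨hs, hx⟩) hsu.le)

lemma pairwiseDisjoint_firstExceed (B : ℝ≥0 → Ω → ℝ) (F : Finset ℝ≥0) (x : ℝ) :
    (F : Set ℝ≥0).PairwiseDisjoint (firstExceed B F x) := by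
  intro s hs t ht hst
  rw [Function.onFun, Set.disjoint_left]
  rintro ω ⟨h1, h2⟩ ⟨h3, h4⟩
  rcases lt_or_gt_of_ne hst with h | h
  · exact (h3 s hs h).not_gt h2
  · exact (h1 t ht h).not_gt h4

/-- The equidistant grid of mesh `d / (n + 1)` on `[0, d]`. -/
noncomputable def timeGrid (d : ℝ≥0) (n : ℕ) : Finset ℝ≥0 :=
  (Finset.range (n + 2)).image fun k : ℕ ↦ d * k / (n + 1)

lemma le_of_mem_timeGrid {d t : ℝ≥0} {n : ℕ} (ht : t ∈ timeGrid d n) : t ≤ d := by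
  obtain ⟨k, hk, rfl⟩ := Finset.mem_image.1 ht
  refine div_le_of_le_mul₀ (by positivity) (by positivity) ?_
  gcongr
  exact_mod_cast Nat.lt_succ_iff.1 (Finset.mem_range.1 hk)

lemma mem_timeGrid (d : ℝ≥0) (n : ℕ) : d ∈ timeGrid d n := by
  refine Finset.mem_image.2 ⟨n + 1, by simp, ?_⟩
  push_cast
  field_simp

lemma exists_mem_timeGrid_lt {d t : ℝ≥0} {n : ℕ} (ht : t ∈ timeGrid d n) (h0 : t ≠ 0) :
    ∃ s ∈ timeGrid d n, s < t ∧ dist t s = d / (n + 1) := by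
  obtain ⟨k, hk, rfl⟩ := Finset.mem_image.1 ht
  have hd : d ≠ 0 := by rintro rfl; simp at h0
  obtain ⟨j, rfl⟩ : ∃ j, k = j + 1 := Nat.exists_eq_succ_of_ne_zero (by rintro rfl; simp at h0)
  refine ⟨d * j / (n + 1), Finset.mem_image.2 ⟨j, ?_, rfl⟩, ?_, ?_⟩
  · have := Finset.mem_range.1 hk
    exact Finset.mem_range.2 (by omega)
  · have := pos_iff_ne_zero.2 hd
    gcongr
    simp
  · rw [NNReal.dist_eq]
    push_cast
    rw [← sub_div, ← mul_sub, add_sub_cancel_left, mul_one, abs_of_nonneg (by positivity)]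

/-- Controls the overshoot: on a fine grid consecutive values differ by less than f(d) - x, and the
value just before the first exceedance is at most x, so the path is still below f(d) at that
exceedance. -/
lemma eventually_exists_firstExceed {f : ℝ≥0 → Ω → ℝ} {ω : Ω} (hf : Continuous (f · ω)) {d : ℝ≥0}
    {x : ℝ} (h0 : f 0 ω ≤ x) (hx : x < f d ω) :
    ∀ᶠ n in atTop, ω ∈ ⋃ t ∈ timeGrid d n,
      firstExceed f (timeGrid d n) x t ∩ {ω | f d ω - f t ω ∈ Ioi 0} := by
  have huc := (isCompact_Icc (a := 0) (b := d)).uniformContinuousOn_of_continuous hf.continuousOn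
  obtain ⟨δ, hδ, H⟩ := Metric.uniformContinuousOn_iff.1 huc (f d ω - x) (sub_pos.2 hx)
  have hlim : Tendsto (fun n : ℕ ↦ (d : ℝ) / (n + 1)) atTop (𝓝 0) := by
    have := tendsto_one_div_add_atTop_nhds_zero_nat (𝕜 := ℝ) |>.const_mul (d : ℝ)
    simpa [div_eq_mul_inv] using this
  filter_upwards [hlim.eventually_lt_const hδ] with n hn
  have h1 : ω ∈ ⋃ t ∈ timeGrid d n, firstExceed f (timeGrid d n) x t := by
    rw [biUnion_firstExceed]
    exact ⟨d, mem_timeGrid d n, hx⟩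
  simp only [mem_iUnion] at h1 ⊢
  obtain ⟨t, ht, h2⟩ := h1
  refine ⟨t, ht, h2, ?_⟩
  have ht0 : t ≠ 0 := by
    rintro rfl
    exact h0.not_gt h2.2
  obtain ⟨s, hs, hst, hd⟩ := exists_mem_timeGrid_lt ht ht0
  have h3 := H t ⟨zero_le, le_of_mem_timeGrid ht⟩ s ⟨zero_le, le_of_mem_timeGrid hs⟩ (hd ▸ hn)
  have h4 := h2.1 s hs hst
  rw [Real.dist_eq] at h3
  have := (abs_lt.1 h3).2
  simp only [mem_ofPred_eq, mem_Ioi]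
  linarith

variable [MeasurableSpace Ω] {P : Measure Ω} {B : ℝ≥0 → Ω → ℝ}

lemma nullMeasurableSet_firstExceed (hB : IsPreBrownianReal B P) (F : Finset ℝ≥0) (x : ℝ)
    (t : ℝ≥0) : NullMeasurableSet (firstExceed B F x t) P := by
  have : firstExceed B F x t =
      (⋂ s ∈ F, ⋂ _ : s < t, {ω | B s ω ≤ x}) ∩ {ω | x < B t ω} := by
    ext ω; simp [firstExceed]
  rw [this]
  refine NullMeasurableSet.inter ?_ (nullMeasurableSet_lt aemeasurable_const (hB.aemeasurable t))
  refine NullMeasurableSet.biInter F.countable_toSet fun s _ ↦ NullMeasurableSet.iInter fun _ ↦ ?_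
  exact nullMeasurableSet_le (hB.aemeasurable s) aemeasurable_const

/-- The first exceedance at t depends only on the path up to t, hence is independent of the
increment from t to d. -/
lemma measureReal_firstExceed_inter (hB : IsPreBrownianReal B P) (F : Finset ℝ≥0) (x : ℝ)
    {t d : ℝ≥0} (htd : t ≤ d) {S : Set ℝ} (hS : MeasurableSet S) :
    P.real (firstExceed B F x t ∩ {ω | B d ω - B t ω ∈ S}) =
      P.real (firstExceed B F x t) * P.real {ω | B d ω - B t ω ∈ S} := by
  have hind := hB.indepFun_shift t
  have hm1 : MeasurableSet {y : ℝ≥0 → ℝ | y (d - t) ∈ S} := measurable_pi_apply (d - t) hS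
  have hm2 : MeasurableSet {y : Set.Iic t → ℝ |
      (∀ s : Set.Iic t, s.1 ∈ F → s.1 < t → y s ≤ x) ∧ x < y ⟨t, self_mem_Iic⟩} := by
    refine MeasurableSet.inter ?_ (measurableSet_lt measurable_const (measurable_pi_apply _))
    have : {y : Set.Iic t → ℝ | ∀ s : Set.Iic t, s.1 ∈ F → s.1 < t → y s ≤ x} =
        ⋂ s ∈ {s : Set.Iic t | s.1 ∈ F}, ⋂ _ : s.1 < t, {y | y s ≤ x} := by
      ext y; simp
    change MeasurableSet {y : Set.Iic t → ℝ | ∀ s : Set.Iic t, s.1 ∈ F → s.1 < t → y s ≤ x}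
    rw [this]
    refine MeasurableSet.biInter
      ((F.countable_toSet.preimage Subtype.val_injective)) fun s _ ↦ MeasurableSet.iInter fun _ ↦ ?_
    exact measurableSet_le (measurable_pi_apply s) measurable_const
  have h := hind.measure_inter_preimage_eq_mul _ _ hm1 hm2
  have e1 : (fun ω s ↦ B (t + s) ω - B t ω) ⁻¹' {y : ℝ≥0 → ℝ | y (d - t) ∈ S} =
      {ω | B d ω - B t ω ∈ S} := by
    ext ω; simp [add_tsub_cancel_of_le htd]
  have e2 : (fun ω (s : Set.Iic t) ↦ B s ω) ⁻¹' {y : Set.Iic t → ℝ |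
      (∀ s : Set.Iic t, s.1 ∈ F → s.1 < t → y s ≤ x) ∧ x < y ⟨t, self_mem_Iic⟩} =
      firstExceed B F x t := by
    ext ω
    simp only [firstExceed, mem_preimage, mem_ofPred_eq, Subtype.forall, mem_Iic]
    exact ⟨fun h ↦ ⟨fun s hs hst ↦ h.1 s hst.le hs hst, h.2⟩,
      fun h ↦ ⟨fun s _ hs hst ↦ h.1 s hs hst, h.2⟩⟩
  rw [e1, e2] at h
  simp only [Measure.real]
  rw [inter_comm, h, ENNReal.toReal_mul, mul_comm]

lemma measureReal_sub_pos_eq_measureReal_sub_neg (hB : IsPreBrownianReal B P) (s t : ℝ≥0) :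
    P.real {ω | B s ω - B t ω ∈ Ioi 0} = P.real {ω | B s ω - B t ω ∈ Iio 0} := by
  have e1 := (hB.hasLaw_sub s t).measureReal_eq (p := (· ∈ Iio 0)) measurableSet_Iio
  have e2 := (hB.neg.hasLaw_sub s t).measureReal_eq (p := (· ∈ Iio 0)) measurableSet_Iio
  rw [← e1] at e2
  refine Eq.trans ?_ e2
  congr 1
  ext ω
  simp

/-- Only an inequality, since the increment is almost surely 0 when s = t. The strict and non-strict
versions err in opposite directions, as the two halves of the reflection principle require. -/
lemma measureReal_sub_pos_le (hB : IsPreBrownianReal B P) (s t : ℝ≥0) :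
    P.real {ω | B s ω - B t ω ∈ Ioi 0} ≤ 1 / 2 := by
  have : IsProbabilityMeasure P := hB.isGaussianProcess.isProbabilityMeasure
  have h := measureReal_union₀ (μ := P) (s := {ω | B s ω - B t ω ∈ Ioi 0})
    (t := {ω | B s ω - B t ω ∈ Iio 0})
    (((hB.aemeasurable s).sub (hB.aemeasurable t)).nullMeasurableSet_preimage measurableSet_Iio)
    (Disjoint.aedisjoint (Set.disjoint_left.2 fun ω h1 h2 ↦ lt_asymm (mem_Ioi.1 (mem_ofPred_eq ▸ h1)) (mem_Iio.1 (mem_ofPred_eq ▸ h2))))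
  have h2 := measureReal_sub_pos_eq_measureReal_sub_neg hB s t
  have h3 := measureReal_le_one (μ := P)
    (s := {ω | B s ω - B t ω ∈ Ioi 0} ∪ {ω | B s ω - B t ω ∈ Iio 0})
  linarith

lemma le_measureReal_sub_nonneg (hB : IsPreBrownianReal B P) (s t : ℝ≥0) :
    1 / 2 ≤ P.real {ω | B s ω - B t ω ∈ Ici 0} := by
  have : IsProbabilityMeasure P := hB.isGaussianProcess.isProbabilityMeasure
  have h := measureReal_add_measureReal_compl₀ (μ := P) (s := {ω | B s ω - B t ω ∈ Ici 0})
    (((hB.aemeasurable s).sub (hB.aemeasurable t)).nullMeasurableSet_preimage measurableSet_Ici)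
  have e : {ω | B s ω - B t ω ∈ Ici 0}ᶜ = {ω | B s ω - B t ω ∈ Iio 0} := by
    ext ω; simp
  have h2 := measureReal_sub_pos_eq_measureReal_sub_neg hB s t
  have h3 := measureReal_sub_pos_le hB s t
  rw [e, probReal_univ] at h
  linarith

/-- After the first exceedance the path ends at least as high with probability at least 1/2, and
then it ends above x. -/
lemma measureReal_exists_mem_finset_gt_le (hB : IsPreBrownianReal B P) {F : Finset ℝ≥0} {d : ℝ≥0}
    (hF : ∀ t ∈ F, t ≤ d) (x : ℝ) :
    P.real {ω | ∃ t ∈ F, x < B t ω} ≤ 2 * P.real {ω | x < B d ω} := by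
  have : IsProbabilityMeasure P := hB.isGaussianProcess.isProbabilityMeasure
  have hm (t : ℝ≥0) : NullMeasurableSet
      (firstExceed B F x t ∩ {ω | B d ω - B t ω ∈ Ici 0}) P :=
    (nullMeasurableSet_firstExceed hB F x t).inter
      (((hB.aemeasurable d).sub (hB.aemeasurable t)).nullMeasurableSet_preimage measurableSet_Ici)
  have hd : Set.Pairwise (F : Set ℝ≥0) (Function.onFun (AEDisjoint P)
      fun t ↦ firstExceed B F x t ∩ {ω | B d ω - B t ω ∈ Ici 0}) := fun s hs t ht hst ↦
    ((pairwiseDisjoint_firstExceed B F x hs ht hst).mono inter_subset_left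
      inter_subset_left).aedisjoint
  calc P.real {ω | ∃ t ∈ F, x < B t ω}
      ≤ ∑ t ∈ F, P.real (firstExceed B F x t) := by
        rw [← biUnion_firstExceed]; exact measureReal_biUnion_finset_le _ _
    _ ≤ ∑ t ∈ F, 2 * P.real (firstExceed B F x t ∩ {ω | B d ω - B t ω ∈ Ici 0}) := by
        refine Finset.sum_le_sum fun t ht ↦ ?_
        rw [measureReal_firstExceed_inter hB F x (hF t ht) measurableSet_Ici]
        nlinarith [le_measureReal_sub_nonneg hB d t,
          measureReal_nonneg (μ := P) (s := firstExceed B F x t)]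
    _ = 2 * P.real (⋃ t ∈ F, firstExceed B F x t ∩ {ω | B d ω - B t ω ∈ Ici 0}) := by
        rw [← Finset.mul_sum, measureReal_biUnion_finset₀ hd fun t _ ↦ hm t]
    _ ≤ 2 * P.real {ω | x < B d ω} := by
        gcongr
        · exact measure_ne_top _ _
        refine iUnion₂_subset fun t ht ω hω ↦ ?_
        have h1 := hω.1.2
        have h2 : 0 ≤ B d ω - B t ω := hω.2
        simp only [mem_ofPred_eq]
        linarith

lemma measureReal_firstExceed_lt_le (hB : IsPreBrownianReal B P) {F : Finset ℝ≥0} {d : ℝ≥0}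
    (hF : ∀ t ∈ F, t ≤ d) (x : ℝ) :
    2 * P.real (⋃ t ∈ F, firstExceed B F x t ∩ {ω | B d ω - B t ω ∈ Ioi 0}) ≤
      P.real {ω | ∃ t ∈ F, x < B t ω} := by
  have : IsProbabilityMeasure P := hB.isGaussianProcess.isProbabilityMeasure
  calc 2 * P.real (⋃ t ∈ F, firstExceed B F x t ∩ {ω | B d ω - B t ω ∈ Ioi 0})
      ≤ 2 * ∑ t ∈ F, P.real (firstExceed B F x t ∩ {ω | B d ω - B t ω ∈ Ioi 0}) := by
        gcongr; exact measureReal_biUnion_finset_le _ _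
    _ ≤ ∑ t ∈ F, P.real (firstExceed B F x t) := by
        rw [Finset.mul_sum]
        refine Finset.sum_le_sum fun t ht ↦ ?_
        rw [measureReal_firstExceed_inter hB F x (hF t ht) measurableSet_Ioi]
        nlinarith [measureReal_sub_pos_le hB d t,
          measureReal_nonneg (μ := P) (s := firstExceed B F x t)]
    _ = P.real {ω | ∃ t ∈ F, x < B t ω} := by
        rw [← biUnion_firstExceed, measureReal_biUnion_finset₀
          (pairwiseDisjoint_firstExceed B F x).aedisjoint
          fun t _ ↦ nullMeasurableSet_firstExceed hB F x t]

/-- A sequence of times that is dense in `[0, d]`. -/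
noncomputable def denseTime (d : ℝ≥0) (n : ℕ) : ℝ≥0 :=
  (TopologicalSpace.denseSeq (Set.Iic d) n : ℝ≥0)

lemma denseTime_le (d : ℝ≥0) (n : ℕ) : denseTime d n ≤ d :=
  (TopologicalSpace.denseSeq (Set.Iic d) n).2

lemma exists_denseTime_mem {d s : ℝ≥0} (hs : s ≤ d) {f : ℝ≥0 → ℝ} (hf : Continuous f) {U : Set ℝ}
    (hU : IsOpen U) (h : f s ∈ U) : ∃ n, f (denseTime d n) ∈ U := by
  obtain ⟨n, hn⟩ := (TopologicalSpace.denseRange_denseSeq (Set.Iic d)).exists_mem_open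
    (hU.preimage (hf.comp continuous_subtype_val)) ⟨⟨s, hs⟩, h⟩
  exact ⟨n, hn⟩

/-- Exceeding x is an open condition, so for continuous paths a countable dense set of times detects
it; exhaust that set by finite ones. -/
lemma measureReal_exists_gt_le (hB : IsBrownianReal B P) (d : ℝ≥0) (x : ℝ) :
    P.real {ω | ∃ s ≤ d, x < B s ω} ≤ 2 * P.real {ω | x < B d ω} := by
  have : IsProbabilityMeasure P := hB.isGaussianProcess.isProbabilityMeasure
  let U : ℕ → Set Ω := fun N ↦ {ω | ∃ t ∈ (Finset.range N).image (denseTime d), x < B t ω}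
  have hU : Monotone U := by
    rintro m n hmn ω ⟨t, ht, h⟩
    exact ⟨t, Finset.image_subset_image (Finset.range_subset_range.2 hmn) ht, h⟩
  have hlim := (ENNReal.tendsto_toReal (measure_ne_top P _)).comp
    (tendsto_measure_iUnion_atTop (μ := P) hU)
  refine le_trans ?_ (le_of_tendsto' hlim fun N ↦
    measureReal_exists_mem_finset_gt_le hB.toIsPreBrownianReal (fun t ht ↦ ?_) x)
  · refine ENNReal.toReal_mono (measure_ne_top P _) (measure_mono_ae ?_)
    filter_upwards [hB.cont] with ω hω
    rintro ⟨s, hs, hx⟩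
    obtain ⟨n, hn⟩ := exists_denseTime_mem hs hω isOpen_Ioi (mem_Ioi.2 hx)
    exact mem_iUnion.2 ⟨n + 1, denseTime d n,
      Finset.mem_image_of_mem _ (Finset.mem_range.2 n.lt_succ_self), hn⟩
  · obtain ⟨n, -, rfl⟩ := Finset.mem_image.1 ht
    exact denseTime_le d n

lemma le_measureReal_exists_gt (hB : IsBrownianReal B P) (d : ℝ≥0) {x : ℝ} (hx : 0 ≤ x) :
    2 * P.real {ω | x < B d ω} ≤ P.real {ω | ∃ s ≤ d, x < B s ω} := by
  have : IsProbabilityMeasure P := hB.isGaussianProcess.isProbabilityMeasure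
  let E : ℕ → Set Ω := fun n ↦ ⋃ t ∈ timeGrid d n,
    firstExceed B (timeGrid d n) x t ∩ {ω | B d ω - B t ω ∈ Ioi 0}
  -- The events `E n` need not be monotone in n. Almost every path ending above x lies in all late
  -- `E n`, hence in the increasing union of the `C N`.
  let C : ℕ → Set Ω := fun N ↦ ⋂ n ≥ N, E n
  have hC : Monotone C := fun m n hmn ↦ iInter₂_mono' fun i hi ↦ ⟨i, hmn.trans hi, subset_rfl⟩
  have hlim := ((ENNReal.tendsto_toReal (measure_ne_top P _)).comp
    (tendsto_measure_iUnion_atTop (μ := P) hC)).const_mul 2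
  refine le_trans ?_ (le_of_tendsto' hlim fun N ↦ ?_)
  · refine mul_le_mul_of_nonneg_left (ENNReal.toReal_mono (measure_ne_top P _)
      (measure_mono_ae ?_)) zero_le_two
    filter_upwards [hB.cont, hB.eval_zero_ae_eq_zero] with ω hω h0 hxd
    obtain ⟨N, hN⟩ := eventually_atTop.1
      (eventually_exists_firstExceed hω (h0.trans_le hx) (mem_ofPred_eq.mp hxd))
    exact mem_iUnion.2 ⟨N, mem_iInter₂.2 hN⟩
  · calc 2 * P.real (C N) ≤ 2 * P.real (E N) :=
        mul_le_mul_of_nonneg_left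
          (measureReal_mono (iInter₂_subset N le_rfl) (measure_ne_top P _)) zero_le_two
      _ ≤ P.real {ω | ∃ t ∈ timeGrid d N, x < B t ω} :=
        measureReal_firstExceed_lt_le hB.toIsPreBrownianReal (fun t ↦ le_of_mem_timeGrid) x
      _ ≤ _ := by
        refine measureReal_mono ?_
        rintro ω ⟨t, ht, h⟩
        exact ⟨t, le_of_mem_timeGrid ht, h⟩

/-- The **reflection principle** for Brownian motion. -/
theorem measureReal_exists_gt (hB : IsBrownianReal B P) (d : ℝ≥0) {x : ℝ} (hx : 0 ≤ x) :
    P.real {ω | ∃ s ≤ d, x < B s ω} = 2 * P.real {ω | x < B d ω} :=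
  (measureReal_exists_gt_le hB d x).antisymm (le_measureReal_exists_gt hB d hx)

end

/-! ### Conditioning on the position at time a. -/

section

lemma continuous_gaussTailDiv (d : ℝ) : Continuous fun x ↦ gaussTailDiv x d := by
  have := continuous_gaussTail
  by_cases hd : d = 0
  · simpa [gaussTailDiv, hd] using continuous_const
  · simp only [gaussTailDiv, hd, if_false]
    fun_prop

lemma gaussTailDiv_nonneg (x d : ℝ) : 0 ≤ gaussTailDiv x d := by
  unfold gaussTailDiv
  split_ifs
  exacts [le_rfl, gaussTail_nonneg _]

lemma gaussTailDiv_le_one (x d : ℝ) : gaussTailDiv x d ≤ 1 := by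
  unfold gaussTailDiv
  split_ifs
  exacts [zero_le_one, gaussTail_le_one _]

lemma gaussianReal_zero_eq_map (v : ℝ≥0) :
    gaussianReal 0 v = (gaussianReal 0 1).map (√(v : ℝ) * ·) := by
  rw [gaussianReal_map_const_mul, mul_zero, mul_one]
  congr
  ext
  simp

lemma gaussianReal_real_Ioi {v : ℝ≥0} (hv : v ≠ 0) (x : ℝ) :
    (gaussianReal 0 v).real (Ioi x) = gaussTail (x / √(v : ℝ)) := by
  have hv' : 0 < √(v : ℝ) := Real.sqrt_pos.2 (by exact_mod_cast pos_iff_ne_zero.2 hv)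
  have e : (√(v : ℝ) * ·) ⁻¹' Ioi x = Ioi (x / √(v : ℝ)) := by
    ext y
    simp [div_lt_iff₀' hv']
  rw [gaussianReal_zero_eq_map, map_measureReal_apply (by fun_prop) measurableSet_Ioi, e,
    Measure.real, gaussianReal_apply_eq_integral 0 one_ne_zero,
    ENNReal.toReal_ofReal (integral_nonneg (gaussianPDFReal_nonneg _ _)),
    ← gaussDensity_eq_gaussianPDFReal, gaussTail]

lemma integral_gaussianReal_zero (v : ℝ≥0) (g : ℝ → ℝ) (hg : Measurable g) :
    ∫ w, g w ∂gaussianReal 0 v = ∫ z, g (√(v : ℝ) * z) * gaussDensity z := by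
  rw [gaussianReal_zero_eq_map, integral_map (by fun_prop) hg.aestronglyMeasurable,
    integral_gaussianReal_eq_integral_smul one_ne_zero, gaussDensity_eq_gaussianPDFReal]
  simp [mul_comm]

variable {Ω : Type*}

lemma infAbsSub_nonneg (W : ℝ≥0 → Ω → ℝ) (M : ℝ) (a b : ℝ≥0) (ω : Ω) :
    0 ≤ infAbsSub W M a b ω :=
  Real.iInf_nonneg fun _ ↦ abs_nonneg _

/-- Turns an uncountable infimum into a countable condition on `W a` and the later increments, which
is the form independence can be applied to. -/
lemma infAbsSub_lt_iff {W : ℝ≥0 → Ω → ℝ} {M : ℝ} {a b : ℝ≥0} (hab : a ≤ b) {ω : Ω}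
    (hω : Continuous (W · ω)) {c : ℝ} :
    infAbsSub W M a b ω < c ↔
      ∃ n, |W a ω - M + (W (a + denseTime (b - a) n) ω - W a ω)| < c := by
  have : Nonempty (Set.Icc a b) := ⟨⟨a, le_rfl, hab⟩⟩
  rw [infAbsSub, ciInf_lt_iff ⟨0, by rintro _ ⟨t, rfl⟩; exact abs_nonneg _⟩]
  have e (t : ℝ≥0) : W a ω - M + (W (a + t) ω - W a ω) = W (a + t) ω - M := by ring
  simp only [e]
  constructor
  · rintro ⟨⟨t, hat, htb⟩, h⟩
    refine exists_denseTime_mem (tsub_le_tsub_right htb a) (f := fun s ↦ |W (a + s) ω - M|)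
      (by fun_prop) (isOpen_Iio (a := c)) ?_
    simpa [add_tsub_cancel_of_le hat] using h
  · rintro ⟨n, hn⟩
    exact ⟨⟨a + denseTime (b - a) n, le_self_add,
      (add_le_add_right (denseTime_le _ n) a).trans_eq (add_tsub_cancel_of_le hab)⟩, hn⟩

variable [MeasurableSpace Ω] {P : Measure Ω} {B : ℝ≥0 → Ω → ℝ}

/-- At d = 0 the conventional value 0 is the true probability even for x = 0, because the inequality
is strict. -/
lemma measureReal_gt_eq_gaussTailDiv (hB : IsPreBrownianReal B P) (d : ℝ≥0) {x : ℝ} (hx : 0 ≤ x) :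
    P.real {ω | x < B d ω} = gaussTailDiv x d := by
  rcases eq_or_ne d 0 with rfl | hd
  · have : P {ω | x < B 0 ω} = 0 := by
      refine measure_mono_null (fun ω hω ↦ ?_) (ae_iff.1 hB.eval_zero_ae_eq_zero)
      exact (hx.trans_lt hω).ne'
    simp [Measure.real, this, gaussTailDiv]
  · rw [(hB.hasLaw_eval d).measureReal_eq (p := (x < ·)) measurableSet_Ioi]
    simp only [gaussTailDiv, NNReal.coe_eq_zero, hd, if_false]
    exact gaussianReal_real_Ioi hd x

/-- The probability that a Brownian motion started at distance `y` from the origin comes within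
distance less than `c` of the origin up to time `d`. -/
noncomputable def nearProb (d y c : ℝ) : ℝ :=
  if y < c then 1 else 2 * gaussTailDiv (y - c) d

lemma exists_eq_zero_of_continuous {f : ℝ≥0 → ℝ} (hf : Continuous f) (h0 : 0 ≤ f 0) {s : ℝ≥0}
    (hs : f s ≤ 0) : ∃ t ≤ s, f t = 0 := by
  obtain ⟨t, ht, h⟩ := intermediate_value_Icc' (zero_le (a := s)) hf.continuousOn ⟨hs, h0⟩
  exact ⟨t, ht.2, h⟩

lemma measureReal_exists_abs_lt (hB : IsBrownianReal B P) (d : ℝ≥0) (v : ℝ) {c : ℝ} (hc : 0 < c) :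
    P.real {ω | ∃ n, |v + B (denseTime d n) ω| < c} = nearProb d |v| c := by
  wlog hv : 0 ≤ v generalizing v B
  · rw [← abs_neg v, ← this hB.neg (-v) (by linarith)]
    congr 1
    ext ω
    simp only [Pi.neg_apply, mem_ofPred_eq, ← neg_add, abs_neg]
  have : IsProbabilityMeasure P := hB.isGaussianProcess.isProbabilityMeasure
  rw [abs_of_nonneg hv, nearProb]
  split_ifs with hvc
  · have : {ω | ∃ n, |v + B (denseTime d n) ω| < c} =ᵐ[P] univ := by
      refine eventuallyEq_univ.2 ?_
      filter_upwards [hB.cont, hB.eval_zero_ae_eq_zero] with ω hω h0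
      obtain ⟨n, hn⟩ := exists_denseTime_mem (zero_le (a := d))
        (f := fun s ↦ |v + B s ω|) (by fun_prop) (isOpen_Iio (a := c))
        (by simpa [h0, abs_of_nonneg hv] using hvc)
      exact ⟨n, hn⟩
    rw [measureReal_congr this, probReal_univ]
  -- Coming within c of the origin from v ≥ c means that -B exceeds v - c.
  · rw [← measureReal_gt_eq_gaussTailDiv hB.neg.toIsPreBrownianReal d
      (sub_nonneg.2 (not_lt.1 hvc)), ← measureReal_exists_gt hB.neg d (sub_nonneg.2 (not_lt.1 hvc))]
    refine measureReal_congr (eventuallyEq_set.2 ?_)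
    filter_upwards [hB.cont, hB.eval_zero_ae_eq_zero] with ω hω h0
    constructor
    · rintro ⟨n, hn⟩
      refine ⟨denseTime d n, denseTime_le d n, ?_⟩
      have := (abs_lt.1 hn).2
      simp only [Pi.neg_apply]
      linarith
    · rintro ⟨s, hs, h⟩
      simp only [Pi.neg_apply] at h
      -- At time s the path is below c; if it is not positive there, it has passed through 0 on the
      -- way.
      obtain ⟨t, ht, htc⟩ : ∃ t ≤ d, |v + B t ω| < c := by
        rcases le_total 0 (v + B s ω) with h1 | h1
        · exact ⟨s, hs, by rw [abs_of_nonneg h1]; linarith⟩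
        · obtain ⟨t, ht, h2⟩ := exists_eq_zero_of_continuous (f := fun t ↦ v + B t ω)
            (by fun_prop) (by simpa [h0] using hv) h1
          exact ⟨t, ht.trans hs, by rw [h2]; simpa using hc⟩
      obtain ⟨n, hn⟩ := exists_denseTime_mem ht (f := fun s ↦ |v + B s ω|) (by fun_prop)
        (isOpen_Iio (a := c)) htc
      exact ⟨n, hn⟩

/-- The upper bound is `measureReal_exists_abs_lt` as the radius shrinks to 0; the lower bound holds
because crossing 0 forces a zero. For v = 0 and d = 0 the formula would give 0 instead of 1. -/
lemma measureReal_forall_exists_abs_lt (hB : IsBrownianReal B P) (d : ℝ≥0) {v : ℝ} (hv : v ≠ 0) :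
    P.real {ω | ∀ k : ℕ, ∃ n, |v + B (denseTime d n) ω| < 1 / ((k : ℝ) + 1)} =
      2 * gaussTailDiv |v| d := by
  wlog hv0 : 0 < v generalizing v B
  · rw [← abs_neg v, ← this hB.neg (v := -v) (by simpa using hv)
      (neg_pos.2 (lt_of_le_of_ne (not_lt.1 hv0) hv))]
    congr 1
    ext ω
    simp only [Pi.neg_apply, mem_ofPred_eq, ← neg_add, abs_neg]
  have : IsProbabilityMeasure P := hB.isGaussianProcess.isProbabilityMeasure
  apply le_antisymm
  · have hlim : Tendsto (fun k : ℕ ↦ 2 * gaussTailDiv (|v| - 1 / ((k : ℝ) + 1)) d) atTop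
        (𝓝 (2 * gaussTailDiv |v| d)) := by
      have h1 := (tendsto_one_div_add_atTop_nhds_zero_nat (𝕜 := ℝ)).const_sub |v|
      rw [sub_zero] at h1
      exact (((continuous_gaussTailDiv d).tendsto _).comp h1).const_mul 2
    refine ge_of_tendsto hlim ?_
    filter_upwards [(tendsto_one_div_add_atTop_nhds_zero_nat (𝕜 := ℝ)).eventually_lt_const
      (abs_pos.2 hv)] with k hk
    have h1 := measureReal_exists_abs_lt hB d v (c := 1 / ((k : ℝ) + 1)) (by positivity)
    rw [nearProb, if_neg hk.not_gt] at h1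
    rw [← h1]
    exact measureReal_mono fun ω hω ↦ hω k
  · rw [abs_of_pos hv0, ← measureReal_gt_eq_gaussTailDiv hB.neg.toIsPreBrownianReal d hv0.le,
      ← measureReal_exists_gt hB.neg d hv0.le]
    refine ENNReal.toReal_mono (measure_ne_top _ _) (measure_mono_ae ?_)
    filter_upwards [hB.cont, hB.eval_zero_ae_eq_zero] with ω hω h0
    rintro ⟨s, hs, h⟩ k
    simp only [Pi.neg_apply] at h
    obtain ⟨t, ht, h2⟩ := exists_eq_zero_of_continuous (f := fun t ↦ v + B t ω)
      (by fun_prop) (by simpa [h0] using hv0.le) (s := s) (by linarith)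
    obtain ⟨n, hn⟩ := exists_denseTime_mem (ht.trans hs) (f := fun s ↦ |v + B s ω|) (by fun_prop)
      (isOpen_Iio (a := 1 / ((k : ℝ) + 1))) (by rw [h2, abs_zero]; exact mem_Iio.2 (by positivity))
    exact ⟨n, hn⟩

/-- By independence the joint law of the position and the later increments is a product, so its
measure is an integral of sections. -/
lemma measureReal_eq_integral_section {W : ℝ≥0 → Ω → ℝ} (hW : IsPreBrownianReal W P) (a : ℝ≥0)
    (u : ℕ → ℝ≥0) {E : Set (ℝ × (ℕ → ℝ))} (hE : MeasurableSet E) :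
    P.real {ω | (W a ω, fun n ↦ W (a + u n) ω - W a ω) ∈ E} =
      ∫ w, P.real {ω | (w, fun n ↦ W (a + u n) ω - W a ω) ∈ E} ∂gaussianReal 0 a := by
  have : IsProbabilityMeasure P := hW.isGaussianProcess.isProbabilityMeasure
  have hX : AEMeasurable (W a) P := hW.aemeasurable a
  have hY : AEMeasurable (fun ω n ↦ W (a + u n) ω - W a ω) P :=
    aemeasurable_pi_lambda _ fun n ↦ (hW.aemeasurable _).sub (hW.aemeasurable _)
  have m1 : Measurable fun (y : ℝ≥0 → ℝ) (n : ℕ) ↦ y (u n) := by fun_prop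
  have m2 : Measurable fun y : Set.Iic a → ℝ ↦ y ⟨a, self_mem_Iic⟩ :=
    measurable_pi_apply (⟨a, self_mem_Iic⟩ : Set.Iic a)
  have hind : IndepFun (W a) (fun ω n ↦ W (a + u n) ω - W a ω) P :=
    ((hW.indepFun_shift a).comp m1 m2).symm
  have hmap := hind.map_prod_eq_prod_map_map hX hY
  have h1 : P {ω | (W a ω, fun n ↦ W (a + u n) ω - W a ω) ∈ E} =
      P.map (fun ω ↦ (W a ω, fun n ↦ W (a + u n) ω - W a ω)) E :=
    (Measure.map_apply_of_aemeasurable (hX.prodMk hY) hE).symm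
  have := Measure.isProbabilityMeasure_map hY
  rw [Measure.real, h1, hmap, Measure.prod_apply hE, (hW.hasLaw_eval a).map_eq,
    ← integral_toReal (measurable_measure_prodMk_left hE).aemeasurable
      (ae_of_all _ fun _ ↦ measure_lt_top _ _)]
  refine integral_congr_ae (ae_of_all _ fun w ↦ ?_)
  simp only [Measure.real]
  rw [Measure.map_apply_of_aemeasurable hY (measurable_prodMk_left hE)]
  rfl

lemma measurable_nearProb (d M c : ℝ) : Measurable fun w ↦ nearProb d |w - M| c :=
  Measurable.ite (measurableSet_lt (by fun_prop) measurable_const) measurable_const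
    ((((continuous_gaussTailDiv d).comp (by fun_prop)).measurable).const_mul 2)

lemma measureReal_infAbsSub_lt {W : ℝ≥0 → Ω → ℝ} (hW : IsBrownianReal W P) {a b : ℝ≥0}
    (hab : a ≤ b) (M : ℝ) {c : ℝ} (hc : 0 < c) :
    P.real {ω | infAbsSub W M a b ω < c} =
      ∫ z, nearProb (b - a) |√(a : ℝ) * z - M| c * gaussDensity z := by
  have hE : MeasurableSet {p : ℝ × (ℕ → ℝ) | ∃ n, |p.1 - M + p.2 n| < c} := by
    simp only [ofPred_exists]
    exact MeasurableSet.iUnion fun n ↦ measurableSet_lt (by fun_prop) measurable_const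
  have h := measureReal_eq_integral_section hW.toIsPreBrownianReal a (denseTime (b - a)) hE
  rw [← integral_gaussianReal_zero a _ (measurable_nearProb _ M c)]
  refine (measureReal_congr (eventuallyEq_set.2 ?_)).trans (h.trans ?_)
  · filter_upwards [hW.cont] with ω hω
    exact infAbsSub_lt_iff hab hω
  · refine integral_congr_ae (ae_of_all _ fun w ↦ ?_)
    rw [← NNReal.coe_sub hab]
    exact measureReal_exists_abs_lt (hW.shift a) (b - a) (w - M) hc

lemma measureReal_infAbsSub_eq_zero {W : ℝ≥0 → Ω → ℝ} (hW : IsBrownianReal W P) {a b : ℝ≥0}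
    (ha : 0 < a) (hab : a ≤ b) (M : ℝ) :
    P.real {ω | infAbsSub W M a b ω = 0} =
      ∫ z, 2 * gaussTailDiv |√(a : ℝ) * z - M| (b - a) * gaussDensity z := by
  have hE : MeasurableSet
      {p : ℝ × (ℕ → ℝ) | ∀ k : ℕ, ∃ n, |p.1 - M + p.2 n| < 1 / ((k : ℝ) + 1)} := by
    simp only [ofPred_forall, ofPred_exists]
    exact MeasurableSet.iInter fun k ↦ MeasurableSet.iUnion fun n ↦
      measurableSet_lt (by fun_prop) measurable_const
  have h := measureReal_eq_integral_section hW.toIsPreBrownianReal a (denseTime (b - a)) hE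
  rw [← integral_gaussianReal_zero a (fun w ↦ 2 * gaussTailDiv |w - M| (b - a))
    ((((continuous_gaussTailDiv _).comp (by fun_prop)).measurable).const_mul 2)]
  refine (measureReal_congr (eventuallyEq_set.2 ?_)).trans (h.trans ?_)
  · filter_upwards [hW.cont] with ω hω
    simp only [← infAbsSub_lt_iff hab hω]
    refine ⟨fun h0 k ↦ h0 ▸ by positivity, fun hk ↦ le_antisymm ?_ (infAbsSub_nonneg W M a b ω)⟩
    exact ge_of_tendsto' tendsto_one_div_add_atTop_nhds_zero_nat fun k ↦ (hk k).le
  · have := nullSingletonClass_gaussianReal (μ := 0) ha.ne'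
    -- The exceptional starting point of `measureReal_forall_exists_abs_lt` has Gaussian measure 0
    -- because a > 0.
    have hne : ∀ᵐ w ∂gaussianReal 0 a, w ≠ M := by simp [ae_iff]
    refine integral_congr_ae (hne.mono fun w hw ↦ ?_)
    simp only
    rw [← NNReal.coe_sub hab]
    exact measureReal_forall_exists_abs_lt (hW.shift a) (b - a) (sub_ne_zero.2 hw)

end

/-! ### Explicit formulas and the theorem. -/

lemma sqrt_mul_abs_sub_div {a : ℝ} (ha : 0 < a) (M z : ℝ) :
    |√a * z - M| = √a * |z - M / √a| := by
  have h := Real.sqrt_pos.2 ha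
  rw [← abs_of_pos h, ← abs_mul, abs_of_pos h]
  congr 1
  field_simp

lemma integral_gaussTailDiv_eq {a b : ℝ} (ha : 0 < a) (hab : a ≤ b) (M : ℝ) :
    ∫ z, 2 * gaussTailDiv |√a * z - M| (b - a) * gaussDensity z =
      1 - (√(2 / Real.pi) * (M / √a) * wedgeIntegral (M / √a) √(a / b) +
        2 / Real.pi * Real.exp (-(M / √a) ^ 2 / 2) * arctanSqrtDiv a (b - a)) := by
  rcases hab.eq_or_lt with rfl | hlt
  -- For a = b the integral is 0 by convention, and arctan(+∞) = π/2 reduces the claim to the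
  -- limiting identity.
  · have h := one_eq_wedgeIntegral_add (M / √a)
    have : (2 : ℝ) / Real.pi * Real.exp (-(M / √a) ^ 2 / 2) * (Real.pi / 2) =
        Real.exp (-(M / √a) ^ 2 / 2) := by field_simp
    simp only [gaussTailDiv, arctanSqrtDiv, sub_self, if_true, div_self ha.ne', Real.sqrt_one, this,
      mul_zero, zero_mul, integral_zero]
    linarith
  · have hd : 0 < b - a := sub_pos.2 hlt
    have h := one_sub_integral_gaussTail_eq (M / √a) √(a / (b - a))
    have e : √(a / (b - a)) / √(1 + √(a / (b - a)) ^ 2) = √(a / b) := by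
      rw [Real.sq_sqrt (by positivity), ← Real.sqrt_div (by positivity)]
      congr 1
      have hb : b ≠ 0 := (ha.trans hlt).ne'
      field_simp
      ring
    have e2 (z : ℝ) : gaussTailDiv |√a * z - M| (b - a) =
        gaussTail (√(a / (b - a)) * |z - M / √a|) := by
      rw [gaussTailDiv, if_neg hd.ne', sqrt_mul_abs_sub_div ha, Real.sqrt_div ha.le]
      congr 1
      ring
    rw [e] at h
    simp only [e2, arctanSqrtDiv, if_neg hd.ne']
    linarith

lemma wedgeIntegral_div_sqrt {a y : ℝ} (ha : 0 < a) {M : ℝ} (hM : 0 ≤ M) :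
    wedgeIntegral (M / √a) y = ∫ u in (0 : ℝ)..y,
      Real.exp (-(M * u) ^ 2 / (2 * a)) *
        ∫ x in {x : ℝ | |x| ≤ M * √((1 - u ^ 2) / a)}, gaussDensity x := by
  refine intervalIntegral.integral_congr fun u _ ↦ ?_
  rw [setIntegral_abs_le_gaussDensity (by positivity), Real.sqrt_div' _ ha.le, mul_div_assoc',
    div_mul_eq_mul_div, div_mul_eq_mul_div, div_pow, Real.sq_sqrt ha.le]
  congr 2
  field_simp

lemma integral_even_mul_gaussDensity (g : ℝ → ℝ) :
    ∫ z, g |z| * gaussDensity z = 2 * ∫ z in Ioi 0, g z * gaussDensity z := by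
  rw [← integral_comp_abs (f := fun z ↦ g z * gaussDensity z)]
  simp only [gaussDensity_abs]

lemma integrable_mul_gaussDensity {g : ℝ → ℝ} (hg : Measurable g) {C : ℝ} (h : ∀ z, |g z| ≤ C) :
    Integrable fun z ↦ g z * gaussDensity z :=
  integrable_gaussDensity.bdd_mul hg.aestronglyMeasurable (ae_of_all _ h)

lemma integral_nearProb_sub_integral_gaussTailDiv {a : ℝ} (ha : 0 < a) (d : ℝ) {c : ℝ}
    (hc : 0 < c) :
    (∫ z, nearProb d |√a * z - 0| c * gaussDensity z) -
        ∫ z, 2 * gaussTailDiv |√a * z - 0| d * gaussDensity z =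
      2 * (∫ u in (0 : ℝ)..(c / √a), (1 - 2 * gaussTailDiv (u * √a) d) * gaussDensity u) +
        4 * ∫ u in Ioi (c / √a),
          (gaussTailDiv (u * √a - c) d - gaussTailDiv (u * √a) d) * gaussDensity u := by
  have hs : 0 < √a := Real.sqrt_pos.2 ha
  have hT := (continuous_gaussTailDiv d).measurable
  have e (z : ℝ) : |√a * z - 0| = |z| * √a := by
    rw [sub_zero, abs_mul, abs_of_pos hs, mul_comm]
  have m1 : Measurable fun z : ℝ ↦ nearProb d (|z| * √a) c := by
    simp only [← e]
    exact (measurable_nearProb d 0 c).comp (measurable_const_mul √a)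
  have m2 : Measurable fun z : ℝ ↦ 2 * gaussTailDiv (|z| * √a) d :=
    (hT.comp (by fun_prop)).const_mul 2
  have b2 (x : ℝ) : |2 * gaussTailDiv x d| ≤ 2 := by
    rw [abs_of_nonneg (by linarith [gaussTailDiv_nonneg x d])]
    linarith [gaussTailDiv_le_one x d]
  have b1 (y : ℝ) : |nearProb d y c| ≤ 2 := by
    unfold nearProb
    split_ifs
    · norm_num
    · exact b2 _
  have i1 := integrable_mul_gaussDensity m1 (fun z ↦ b1 _)
  have i2 := integrable_mul_gaussDensity m2 (fun z ↦ b2 _)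
  have hi := i1.sub i2
  simp only [e]
  rw [← integral_sub i1 i2]
  simp only [← sub_mul]
  rw [integral_even_mul_gaussDensity
    (fun z ↦ nearProb d (z * √a) c - 2 * gaussTailDiv (z * √a) d)]
  have hi' : IntegrableOn
      (fun z ↦ (nearProb d (z * √a) c - 2 * gaussTailDiv (z * √a) d) * gaussDensity z) (Ioi 0) := by
    refine hi.integrableOn.congr_fun (fun z hz ↦ ?_) measurableSet_Ioi
    simp only [Pi.sub_apply, abs_of_pos (mem_Ioi.1 hz), sub_mul]
  have hc' : 0 < c / √a := by positivity
  -- The integrand was folded onto z > 0 by evenness. It is cut where √a·z = c, the point at which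
  -- `nearProb` changes branch.
  rw [← Ioo_union_Ici_eq_Ioi hc'] at hi' ⊢
  rw [setIntegral_union (Set.disjoint_left.2 fun z h1 h2 ↦ h1.2.not_ge h2) measurableSet_Ici
    hi'.left_of_union hi'.right_of_union,
    intervalIntegral.integral_of_le hc'.le, integral_Ioc_eq_integral_Ioo,
    ← integral_Ici_eq_integral_Ioi, mul_add]
  congr 1
  · congr 1
    refine setIntegral_congr_fun measurableSet_Ioo fun z hz ↦ ?_
    rw [nearProb, if_pos ((lt_div_iff₀ hs).1 hz.2)]
  -- The factor 4 combines the 2 from evenness with the 2 from the reflection principle.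
  · rw [← integral_const_mul, ← integral_const_mul]
    refine setIntegral_congr_fun measurableSet_Ici fun z hz ↦ ?_
    rw [nearProb, if_neg ((div_le_iff₀ hs).1 hz).not_gt]
    ring

lemma measureReal_infAbsSub_eq_zero_eq {Ω : Type*} [MeasurableSpace Ω] {P : Measure Ω}
    {W : ℝ≥0 → Ω → ℝ} (hW : IsBrownianReal W P) {a b : ℝ≥0} (ha : 0 < a) (hab : a ≤ b) (M : ℝ) :
    P.real {ω | infAbsSub W M a b ω = 0} =
      -√(2 / Real.pi) * (|M| / √(a : ℝ)) *
          (∫ u in (0 : ℝ)..√((a : ℝ) / b),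
            Real.exp (-(M * u) ^ 2 / (2 * a)) *
              ∫ x in {x : ℝ | |x| ≤ |M| * √((1 - u ^ 2) / a)}, gaussDensity x)
        + (1 - 2 / Real.pi * Real.exp (-M ^ 2 / (2 * a)) * arctanSqrtDiv a (b - a)) := by
  -- -W is again a Brownian motion, and its distance to -M is that of W to M.
  wlog hM : 0 ≤ M generalizing W M
  · have h := this hW.neg (-M) (by linarith)
    simp only [abs_neg, neg_mul M, neg_sq] at h
    rw [← h]
    congr 1
    ext ω
    have (t : ℝ≥0) : |W t ω - M| = |-W t ω - -M| := by rw [← abs_neg]; ring_nf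
    simp only [infAbsSub, mem_ofPred_eq, Pi.neg_apply, this]
  have ha' : (0 : ℝ) < a := ha
  rw [measureReal_infAbsSub_eq_zero hW ha hab, integral_gaussTailDiv_eq ha' (by exact_mod_cast hab),
    wedgeIntegral_div_sqrt ha' hM, abs_of_nonneg hM, div_pow,
    Real.sq_sqrt ha'.le]
  have : -(M ^ 2 / (a : ℝ)) / 2 = -M ^ 2 / (2 * a) := by field_simp
  rw [this]
  ring

theorem lemma2p3 {Ω : Type*} [MeasurableSpace Ω] (P : Measure Ω) [IsProbabilityMeasure P]
    (W : ℝ≥0 → Ω → ℝ) (hW : IsBrownianReal W P)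
    (a b : ℝ≥0) (ha : 0 < a) (hab : a ≤ b) :
    (∀ M : ℝ,
      P.real {ω | infAbsSub W M a b ω = 0} =
        -√(2 / Real.pi) * (|M| / √(a : ℝ)) *
            (∫ u in (0 : ℝ)..√((a : ℝ) / b),
              Real.exp (-(M * u) ^ 2 / (2 * a)) *
                ∫ x in {x : ℝ | |x| ≤ |M| * √((1 - u ^ 2) / a)}, gaussDensity x)
          + (1 - 2 / Real.pi * Real.exp (-M ^ 2 / (2 * a)) * arctanSqrtDiv a (b - a))) ∧
    P.real {ω | infAbsSub W 0 a b ω = 0} = 1 - 2 / Real.pi * arctanSqrtDiv a (b - a) ∧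
    (∀ c : ℝ, 0 < c →
      P.real {ω | 0 < infAbsSub W 0 a b ω ∧ infAbsSub W 0 a b ω < c} =
        2 * (∫ u in (0 : ℝ)..(c / √(a : ℝ)),
              (1 - 2 * gaussTailDiv (u * √(a : ℝ)) (b - a)) * gaussDensity u)
          + 4 * ∫ u in Set.Ioi (c / √(a : ℝ)),
              (gaussTailDiv (u * √(a : ℝ) - c) (b - a) - gaussTailDiv (u * √(a : ℝ)) (b - a)) *
                gaussDensity u) := by
  refine ⟨measureReal_infAbsSub_eq_zero_eq hW ha hab, ?_, fun c hc ↦ ?_⟩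
  · rw [measureReal_infAbsSub_eq_zero_eq hW ha hab]
    simp
  -- Needed to subtract measures. Up to a null set the event is a countable intersection of
  -- countable unions of events at single times.
  · have hnull : NullMeasurableSet {ω | infAbsSub W 0 a b ω = 0} P := by
      have hlt (k : ℕ) : NullMeasurableSet {ω | infAbsSub W 0 a b ω < 1 / ((k : ℝ) + 1)} P := by
        have h : NullMeasurableSet {ω | ∃ n, |W a ω - 0 + (W (a + denseTime (b - a) n) ω - W a ω)|
            < 1 / ((k : ℝ) + 1)} P := by
          simp only [ofPred_exists]
          refine NullMeasurableSet.iUnion fun n ↦ nullMeasurableSet_lt ?_ aemeasurable_const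
          have h1 := hW.aemeasurable a
          have h2 := hW.aemeasurable (a + denseTime (b - a) n)
          exact ((h1.sub_const 0).add (h2.sub h1)).abs
        refine h.congr (eventuallyEq_set.2 ?_)
        filter_upwards [hW.cont] with ω hω
        exact (infAbsSub_lt_iff hab hω).symm
      have e : {ω | infAbsSub W 0 a b ω = 0} =
          ⋂ k : ℕ, {ω | infAbsSub W 0 a b ω < 1 / ((k : ℝ) + 1)} := by
        ext ω
        simp only [mem_iInter, mem_ofPred_eq]
        refine ⟨fun h0 k ↦ by rw [h0]; positivity, fun hk ↦ ?_⟩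
        exact le_antisymm (ge_of_tendsto' tendsto_one_div_add_atTop_nhds_zero_nat
          fun k ↦ (hk k).le) (infAbsSub_nonneg W 0 a b ω)
      rw [e]
      exact NullMeasurableSet.iInter hlt
    have hset : {ω | 0 < infAbsSub W 0 a b ω ∧ infAbsSub W 0 a b ω < c} =
        {ω | infAbsSub W 0 a b ω < c} \ {ω | infAbsSub W 0 a b ω = 0} := by
      ext ω
      have := infAbsSub_nonneg W 0 a b ω
      simp only [mem_ofPred_eq, Set.mem_sdiff, this.lt_iff_ne', ne_eq]
      tauto
    have hsub : {ω | infAbsSub W 0 a b ω = 0} ⊆ {ω | infAbsSub W 0 a b ω < c} := by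
      intro ω (h : infAbsSub W 0 a b ω = 0)
      exact h.trans_lt hc
    rw [hset, Measure.real, measure_sdiff hsub hnull (measure_ne_top P _),
      ENNReal.toReal_sub_of_le (measure_mono hsub) (measure_ne_top P _)]
    exact (congrArg₂ (· - ·) (measureReal_infAbsSub_lt hW hab 0 hc)
      (measureReal_infAbsSub_eq_zero hW ha hab 0)).trans
      (integral_nearProb_sub_integral_gaussTailDiv ha _ hc)
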